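/- A \emph{Petri net} $P$ is a pair of functions $s,t\colon T\to\mathbb{N}[S]$, where $T$ (transitions) and $S$ (places) are sets and $\mathbb{N}[S]$ is the free commutative monoid on $S$. A morphism from $P$ to $P'=(s',t'\colon T'\to\mathbb{N}[S'])$ is a pair of functions $f\colon T\to T'$, $g\colon S\to S'$ with $s'f=\mathbb{N}[g]s$ and $t'f=\mathbb{N}[g]t$. These form a category $\mathsf{Petri}$. Let $L\colon\mathsf{Set}\to\mathsf{Petri}$ be the functor sending a set $X$ to the Petri net with set of places $X$ and no transitions. An \emph{open Petri net} $P\colon X\nrightarrow Y$ is a cospan $LX\xrightarrow{i}P\xleftarrow{o}LY$ in $\mathsf{Petri}$. A \emph{double category} is a category weakly internal to $\mathsf{Cat}$: horizontal composition is associative and unital up to invertible globular 2-morphisms, natural and satisfying the pentagon and triangle identities. A \emph{symmetric monoidal double category} is a symmetric pseudomonoid in the 2-category of double categories, double functors and transformations. The monoidal unit for horizontal 1-cells is taken to be the horizontal identity on the monoidal unit $I$ for objects, and source and target are strict monoidal. \textbf{Theorem.} There is a symmetric monoidal double category $\mathbb{O}\mathbf{pen}(\mathsf{Petri})$ for which: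 \begin{itemize} \item objects are sets; \item vertical 1-morphisms are functions; \item horizontal 1-cells from a set $X$ to a set $Y$ are open Petri nets $LX\xrightarrow{i}P\xleftarrow{o}LY$; \item 2-morphisms from $LX\xrightarrow{i}P\xleftarrow{o}LY$ to $LX'\xrightarrow{i'}P'\xleftarrow{o'}LY'$ with vertical boundary $f\colon X\to X'$, $g\colon Y\to Y'$ are morphisms $\alpha\colon P\to P'$ in $\mathsf{Petri}$ with $\alpha i=i'\,Lf$ and $\alpha o=o'\,Lg$. \end{itemize} Vertical composition of 1-morphisms is composition of functions, and vertical composition of 2-morphisms is composition in $\mathsf{Petri}$. The horizontal identity on $X$ is $LX\xrightarrow{1}LX\xleftarrow{1}LX$. The horizontal composite of $LX\xrightarrow{i_1}P\xleftarrow{o_1}LY$ and $LY\xrightarrow{i_2}Q\xleftarrow{o_2}LZ$ is $LX\xrightarrow{j_Pi_1}P+_{LY}Q\xleftarrow{j_Qo_2}LZ$, where $P\xrightarrow{j_P}P+_{LY}Q\xleftarrow{j_Q}Q$ is a pushout of $o_1$ and $i_2$. The horizontal composite of 2-morphisms $\alpha\colon P\to P'$ and $\beta\colon Q\to Q'$ with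 common vertical boundary $g\colon Y\to Y'$ is the induced map $\alpha+_{Lg}\beta\colon P+_{LY}Q\to P'+_{LY'}Q'$. The associator and unitors for horizontal composition are the canonical maps between pushouts. The symmetric monoidal structure comes from coproducts in $\mathsf{Set}$ and $\mathsf{Petri}$. The tensor product of sets and functions is given by chosen coproducts $X+X'$ in $\mathsf{Set}$, with unit the empty set. The tensor product of $LX\xrightarrow{i}P\xleftarrow{o}LY$ and $LX'\xrightarrow{i'}P'\xleftarrow{o'}LY'$ is $L(X+X')\to P+P'\leftarrow L(Y+Y')$, where $P+P'$ is a chosen coproduct in $\mathsf{Petri}$ and the legs restrict to $i,i'$ and $o,o'$ on the summands. The tensor product of 2-morphisms $\alpha,\alpha'$ is $\alpha+\alpha'$. The associators, unitors and symmetries of the tensor product, and the comparisons of the tensor product with horizontal composition and with horizontal identities, are the canonical maps. -/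

import Mathlib

open CategoryTheory CategoryTheory.Limits
open scoped MonoidalCategory

universe u v w z

/-! ## Double categories

A (pseudo) double category has a category of objects `D₀` and a category of arrows `D₁` with
source and target functors `S, T : D₁ ⥤ D₀`.  We write these data fibrewise: `Hor a b` consists of
the objects `M` of `D₁` with `S M = a`, `T M = b`, and `Sq f g M N` of the morphisms `α : M ⟶ N` of
`D₁` with `S α = f`, `T α = g`.  In this way every equation that involves the values of `S` and `T`
(such as `S (U a) = a`, `S (M ⊙ N) = S M`, or the globularity of the coherence cells)
is part of the typing. -/

/-- The cells of a double category: the category `D₀` of objects and vertical 1-morphisms, the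
horizontal 1-cells, and the 2-morphisms (squares)
```
      a --M--> b
      |        |
      f        g
      v        v
      c --N--> d
```
-/
structure DoubleCells where
  /-- Objects. -/
  Obj : Type u
  /-- Vertical 1-morphisms and their composition. -/
  [vert : Category.{v} Obj]
  /-- Horizontal 1-cells. -/
  Hor : Obj → Obj → Type w
  /-- 2-morphisms with vertical boundary `f`, `g`, from `M` to `N`. -/
  Sq : ∀ {a b c d : Obj}, (a ⟶ c) → (b ⟶ d) → Hor a b → Hor c d → Type z

attribute [instance] DoubleCells.vert

/-- Equality of 2-morphisms `M ⟶ N` as morphisms of `D₁`, that is: equality of the vertical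
boundaries and of the squares.  It is needed because the boundaries of the two sides of an equation
in `D₁` are often only provably equal in `D₀`, for instance `f ≫ 𝟙 c` and `f`. -/
def DoubleCells.SqEq {G : DoubleCells.{u, v, w, z}} {a b c d : G.Obj}
    {M : G.Hor a b} {N : G.Hor c d} {f f' : a ⟶ c} {g g' : b ⟶ d}
    (α : G.Sq f g M N) (β : G.Sq f' g' M N) : Prop :=
  (⟨f, g, α⟩ : Σ (p : a ⟶ c) (q : b ⟶ d), G.Sq p q M N) = ⟨f', g', β⟩

infix:50 " ≗ " => DoubleCells.SqEq

/-- Vertical composition of 2-morphisms: the category structure of `D₁`, for which `S` and `T` are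
functors to `D₀`. -/
structure VerticalStructure (G : DoubleCells.{u, v, w, z}) where
  vid : ∀ {a b : G.Obj} (M : G.Hor a b), G.Sq (𝟙 a) (𝟙 b) M M
  vcomp : ∀ {a b c d e k : G.Obj} {f : a ⟶ c} {g : b ⟶ d} {f' : c ⟶ e} {g' : d ⟶ k}
    {M : G.Hor a b} {N : G.Hor c d} {P : G.Hor e k},
    G.Sq f g M N → G.Sq f' g' N P → G.Sq (f ≫ f') (g ≫ g') M P
  vid_vcomp : ∀ {a b c d : G.Obj} {f : a ⟶ c} {g : b ⟶ d} {M : G.Hor a b} {N : G.Hor c d}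
    (α : G.Sq f g M N), vcomp (vid M) α ≗ α
  vcomp_vid : ∀ {a b c d : G.Obj} {f : a ⟶ c} {g : b ⟶ d} {M : G.Hor a b} {N : G.Hor c d}
    (α : G.Sq f g M N), vcomp α (vid N) ≗ α
  vcomp_assoc : ∀ {a b c d e k m n : G.Obj} {f : a ⟶ c} {g : b ⟶ d} {f' : c ⟶ e} {g' : d ⟶ k}
    {f'' : e ⟶ m} {g'' : k ⟶ n}
    {M : G.Hor a b} {N : G.Hor c d} {P : G.Hor e k} {Q : G.Hor m n}
    (α : G.Sq f g M N) (β : G.Sq f' g' N P) (γ : G.Sq f'' g'' P Q),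
    vcomp (vcomp α β) γ ≗ vcomp α (vcomp β γ)

/-- A 2-morphism is invertible if it is an isomorphism in `D₁`. -/
def VerticalStructure.IsInvertible {G : DoubleCells.{u, v, w, z}} (D : VerticalStructure G)
    {a b c d : G.Obj} {f : a ⟶ c} {g : b ⟶ d} {M : G.Hor a b} {N : G.Hor c d}
    (α : G.Sq f g M N) : Prop :=
  ∃ (f' : c ⟶ a) (g' : d ⟶ b) (β : G.Sq f' g' N M),
    D.vcomp α β ≗ D.vid M ∧ D.vcomp β α ≗ D.vid N

/-- A (pseudo) double category with the given cells.  Horizontal composition `hcomp M N` is written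
in diagrammatic order: first `M`, then `N`. -/
structure DoubleCategory (G : DoubleCells.{u, v, w, z}) extends VerticalStructure G where
  /- The identity-assigning functor `U : D₀ ⥤ D₁`. -/
  hid : ∀ a : G.Obj, G.Hor a a
  hidSq : ∀ {a b : G.Obj} (f : a ⟶ b), G.Sq f f (hid a) (hid b)
  hidSq_id : ∀ a : G.Obj, hidSq (𝟙 a) = vid (hid a)
  hidSq_comp : ∀ {a b c : G.Obj} (f : a ⟶ b) (g : b ⟶ c),
    hidSq (f ≫ g) = vcomp (hidSq f) (hidSq g)
  /- The horizontal composition functor. -/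
  hcomp : ∀ {a b c : G.Obj}, G.Hor a b → G.Hor b c → G.Hor a c
  hcompSq : ∀ {a b c a' b' c' : G.Obj} {f : a ⟶ a'} {g : b ⟶ b'} {h : c ⟶ c'}
    {M : G.Hor a b} {N : G.Hor b c} {M' : G.Hor a' b'} {N' : G.Hor b' c'},
    G.Sq f g M M' → G.Sq g h N N' → G.Sq f h (hcomp M N) (hcomp M' N')
  hcompSq_vid : ∀ {a b c : G.Obj} (M : G.Hor a b) (N : G.Hor b c),
    hcompSq (vid M) (vid N) = vid (hcomp M N)
  hcompSq_vcomp : ∀ {a b c a' b' c' a'' b'' c'' : G.Obj}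
    {f : a ⟶ a'} {g : b ⟶ b'} {h : c ⟶ c'} {f' : a' ⟶ a''} {g' : b' ⟶ b''} {h' : c' ⟶ c''}
    {M : G.Hor a b} {N : G.Hor b c} {M' : G.Hor a' b'} {N' : G.Hor b' c'}
    {M'' : G.Hor a'' b''} {N'' : G.Hor b'' c''}
    (α : G.Sq f g M M') (β : G.Sq g h N N') (α' : G.Sq f' g' M' M'') (β' : G.Sq g' h' N' N''),
    hcompSq (vcomp α α') (vcomp β β') = vcomp (hcompSq α β) (hcompSq α' β')
  /- The associator. -/
  assoc : ∀ {a b c d : G.Obj} (M : G.Hor a b) (N : G.Hor b c) (P : G.Hor c d),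
    G.Sq (𝟙 a) (𝟙 d) (hcomp (hcomp M N) P) (hcomp M (hcomp N P))
  assoc_invertible : ∀ {a b c d : G.Obj} (M : G.Hor a b) (N : G.Hor b c) (P : G.Hor c d),
    toVerticalStructure.IsInvertible (assoc M N P)
  assoc_naturality : ∀ {a b c d a' b' c' d' : G.Obj}
    {f : a ⟶ a'} {g : b ⟶ b'} {h : c ⟶ c'} {k : d ⟶ d'}
    {M : G.Hor a b} {N : G.Hor b c} {P : G.Hor c d}
    {M' : G.Hor a' b'} {N' : G.Hor b' c'} {P' : G.Hor c' d'}
    (α : G.Sq f g M M') (β : G.Sq g h N N') (γ : G.Sq h k P P'),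
    vcomp (hcompSq (hcompSq α β) γ) (assoc M' N' P') ≗
      vcomp (assoc M N P) (hcompSq α (hcompSq β γ))
  /- The unitors. -/
  leftUnitor : ∀ {a b : G.Obj} (M : G.Hor a b), G.Sq (𝟙 a) (𝟙 b) (hcomp (hid a) M) M
  leftUnitor_invertible : ∀ {a b : G.Obj} (M : G.Hor a b),
    toVerticalStructure.IsInvertible (leftUnitor M)
  leftUnitor_naturality : ∀ {a b a' b' : G.Obj} {f : a ⟶ a'} {g : b ⟶ b'}
    {M : G.Hor a b} {M' : G.Hor a' b'} (α : G.Sq f g M M'),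
    vcomp (hcompSq (hidSq f) α) (leftUnitor M') ≗ vcomp (leftUnitor M) α
  rightUnitor : ∀ {a b : G.Obj} (M : G.Hor a b), G.Sq (𝟙 a) (𝟙 b) (hcomp M (hid b)) M
  rightUnitor_invertible : ∀ {a b : G.Obj} (M : G.Hor a b),
    toVerticalStructure.IsInvertible (rightUnitor M)
  rightUnitor_naturality : ∀ {a b a' b' : G.Obj} {f : a ⟶ a'} {g : b ⟶ b'}
    {M : G.Hor a b} {M' : G.Hor a' b'} (α : G.Sq f g M M'),
    vcomp (hcompSq α (hidSq g)) (rightUnitor M') ≗ vcomp (rightUnitor M) α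
  /- The coherence axioms. -/
  pentagon : ∀ {a b c d e : G.Obj} (M : G.Hor a b) (N : G.Hor b c) (P : G.Hor c d) (Q : G.Hor d e),
    vcomp (hcompSq (assoc M N P) (vid Q))
        (vcomp (assoc M (hcomp N P) Q) (hcompSq (vid M) (assoc N P Q))) ≗
      vcomp (assoc (hcomp M N) P Q) (assoc M N (hcomp P Q))
  triangle : ∀ {a b c : G.Obj} (M : G.Hor a b) (N : G.Hor b c),
    vcomp (assoc M (hid b) N) (hcompSq (vid M) (leftUnitor N)) ≗
      hcompSq (rightUnitor M) (vid N)

/-- A monoidal double category: a pseudomonoid in the 2-category of double categories, double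
functors and transformations, with the unit of `D₁` being `U I`, for `I` the unit of `D₀`. -/
structure MonoidalDoubleCategory (G : DoubleCells.{u, v, w, z}) extends DoubleCategory G where
  /-- The monoidal structure of `D₀`. -/
  [monoidal : MonoidalCategory G.Obj]
  /- The monoidal structure of `D₁`, over that of `D₀`, so that `S` and `T` are strict monoidal. -/
  tensorHor : ∀ {a b a' b' : G.Obj}, G.Hor a b → G.Hor a' b' → G.Hor (a ⊗ a') (b ⊗ b')
  tensorSq : ∀ {a b c d a' b' c' d' : G.Obj}
    {f : a ⟶ c} {g : b ⟶ d} {f' : a' ⟶ c'} {g' : b' ⟶ d'}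
    {M : G.Hor a b} {N : G.Hor c d} {M' : G.Hor a' b'} {N' : G.Hor c' d'},
    G.Sq f g M N → G.Sq f' g' M' N' →
      G.Sq (f ⊗ₘ f') (g ⊗ₘ g') (tensorHor M M') (tensorHor N N')
  tensorSq_vid : ∀ {a b a' b' : G.Obj} (M : G.Hor a b) (M' : G.Hor a' b'),
    tensorSq (vid M) (vid M') ≗ vid (tensorHor M M')
  tensorSq_vcomp : ∀ {a b c d e k a' b' c' d' e' k' : G.Obj}
    {f : a ⟶ c} {g : b ⟶ d} {h : c ⟶ e} {l : d ⟶ k}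
    {f' : a' ⟶ c'} {g' : b' ⟶ d'} {h' : c' ⟶ e'} {l' : d' ⟶ k'}
    {M : G.Hor a b} {N : G.Hor c d} {P : G.Hor e k}
    {M' : G.Hor a' b'} {N' : G.Hor c' d'} {P' : G.Hor e' k'}
    (α : G.Sq f g M N) (β : G.Sq h l N P) (α' : G.Sq f' g' M' N') (β' : G.Sq h' l' N' P'),
    tensorSq (vcomp α β) (vcomp α' β') ≗ vcomp (tensorSq α α') (tensorSq β β')
  tensorAssoc : ∀ {a b a' b' a'' b'' : G.Obj}
    (M : G.Hor a b) (M' : G.Hor a' b') (M'' : G.Hor a'' b''),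
    G.Sq (α_ a a' a'').hom (α_ b b' b'').hom
      (tensorHor (tensorHor M M') M'') (tensorHor M (tensorHor M' M''))
  tensorAssocInv : ∀ {a b a' b' a'' b'' : G.Obj}
    (M : G.Hor a b) (M' : G.Hor a' b') (M'' : G.Hor a'' b''),
    G.Sq (α_ a a' a'').inv (α_ b b' b'').inv
      (tensorHor M (tensorHor M' M'')) (tensorHor (tensorHor M M') M'')
  tensorAssoc_hom_inv : ∀ {a b a' b' a'' b'' : G.Obj}
    (M : G.Hor a b) (M' : G.Hor a' b') (M'' : G.Hor a'' b''),
    vcomp (tensorAssoc M M' M'') (tensorAssocInv M M' M'') ≗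
      vid (tensorHor (tensorHor M M') M'')
  tensorAssoc_inv_hom : ∀ {a b a' b' a'' b'' : G.Obj}
    (M : G.Hor a b) (M' : G.Hor a' b') (M'' : G.Hor a'' b''),
    vcomp (tensorAssocInv M M' M'') (tensorAssoc M M' M'') ≗
      vid (tensorHor M (tensorHor M' M''))
  tensorAssoc_naturality : ∀ {a b a' b' a'' b'' c d c' d' c'' d'' : G.Obj}
    {f : a ⟶ c} {g : b ⟶ d} {f' : a' ⟶ c'} {g' : b' ⟶ d'} {f'' : a'' ⟶ c''} {g'' : b'' ⟶ d''}
    {M : G.Hor a b} {M' : G.Hor a' b'} {M'' : G.Hor a'' b''}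
    {N : G.Hor c d} {N' : G.Hor c' d'} {N'' : G.Hor c'' d''}
    (α : G.Sq f g M N) (α' : G.Sq f' g' M' N') (α'' : G.Sq f'' g'' M'' N''),
    vcomp (tensorSq (tensorSq α α') α'') (tensorAssoc N N' N'') ≗
      vcomp (tensorAssoc M M' M'') (tensorSq α (tensorSq α' α''))
  tensorLeftUnitor : ∀ {a b : G.Obj} (M : G.Hor a b),
    G.Sq (λ_ a).hom (λ_ b).hom (tensorHor (hid (𝟙_ G.Obj)) M) M
  tensorLeftUnitor_invertible : ∀ {a b : G.Obj} (M : G.Hor a b),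
    toVerticalStructure.IsInvertible (tensorLeftUnitor M)
  tensorLeftUnitor_naturality : ∀ {a b c d : G.Obj} {f : a ⟶ c} {g : b ⟶ d}
    {M : G.Hor a b} {N : G.Hor c d} (α : G.Sq f g M N),
    vcomp (tensorSq (vid (hid (𝟙_ G.Obj))) α) (tensorLeftUnitor N) ≗
      vcomp (tensorLeftUnitor M) α
  tensorRightUnitor : ∀ {a b : G.Obj} (M : G.Hor a b),
    G.Sq (ρ_ a).hom (ρ_ b).hom (tensorHor M (hid (𝟙_ G.Obj))) M
  tensorRightUnitor_invertible : ∀ {a b : G.Obj} (M : G.Hor a b),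
    toVerticalStructure.IsInvertible (tensorRightUnitor M)
  tensorRightUnitor_naturality : ∀ {a b c d : G.Obj} {f : a ⟶ c} {g : b ⟶ d}
    {M : G.Hor a b} {N : G.Hor c d} (α : G.Sq f g M N),
    vcomp (tensorSq α (vid (hid (𝟙_ G.Obj)))) (tensorRightUnitor N) ≗
      vcomp (tensorRightUnitor M) α
  tensor_pentagon : ∀ {a b a' b' a'' b'' c d : G.Obj}
    (M : G.Hor a b) (M' : G.Hor a' b') (M'' : G.Hor a'' b'') (N : G.Hor c d),
    vcomp (tensorSq (tensorAssoc M M' M'') (vid N))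
        (vcomp (tensorAssoc M (tensorHor M' M'') N) (tensorSq (vid M) (tensorAssoc M' M'' N))) ≗
      vcomp (tensorAssoc (tensorHor M M') M'' N) (tensorAssoc M M' (tensorHor M'' N))
  tensor_triangle : ∀ {a b a' b' : G.Obj} (M : G.Hor a b) (M' : G.Hor a' b'),
    vcomp (tensorAssoc M (hid (𝟙_ G.Obj)) M') (tensorSq (vid M) (tensorLeftUnitor M')) ≗
      tensorSq (tensorRightUnitor M) (vid M')
  /- The composition comparison `χ` and the identity comparison `μ` of the double functor `⊗`. -/
  chi : ∀ {a b c a' b' c' : G.Obj}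
    (M : G.Hor a b) (M' : G.Hor a' b') (N : G.Hor b c) (N' : G.Hor b' c'),
    G.Sq (𝟙 (a ⊗ a')) (𝟙 (c ⊗ c'))
      (hcomp (tensorHor M M') (tensorHor N N')) (tensorHor (hcomp M N) (hcomp M' N'))
  chi_invertible : ∀ {a b c a' b' c' : G.Obj}
    (M : G.Hor a b) (M' : G.Hor a' b') (N : G.Hor b c) (N' : G.Hor b' c'),
    toVerticalStructure.IsInvertible (chi M M' N N')
  chi_naturality : ∀ {a b c a' b' c' x y s x' y' s' : G.Obj}
    {f : a ⟶ x} {g : b ⟶ y} {h : c ⟶ s} {f' : a' ⟶ x'} {g' : b' ⟶ y'} {h' : c' ⟶ s'}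
    {M : G.Hor a b} {M' : G.Hor a' b'} {N : G.Hor b c} {N' : G.Hor b' c'}
    {P : G.Hor x y} {P' : G.Hor x' y'} {Q : G.Hor y s} {Q' : G.Hor y' s'}
    (α : G.Sq f g M P) (α' : G.Sq f' g' M' P') (β : G.Sq g h N Q) (β' : G.Sq g' h' N' Q'),
    vcomp (hcompSq (tensorSq α α') (tensorSq β β')) (chi P P' Q Q') ≗
      vcomp (chi M M' N N') (tensorSq (hcompSq α β) (hcompSq α' β'))
  mu : ∀ a b : G.Obj, G.Sq (𝟙 (a ⊗ b)) (𝟙 (a ⊗ b)) (hid (a ⊗ b)) (tensorHor (hid a) (hid b))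
  mu_invertible : ∀ a b : G.Obj, toVerticalStructure.IsInvertible (mu a b)
  mu_naturality : ∀ {a b a' b' : G.Obj} (f : a ⟶ a') (g : b ⟶ b'),
    vcomp (hidSq (f ⊗ₘ g)) (mu a' b') ≗ vcomp (mu a b) (tensorSq (hidSq f) (hidSq g))
  /- The double functor `⊗` is compatible with the associator and the unitors of the double
  category. -/
  chi_assoc : ∀ {a b c d a' b' c' d' : G.Obj}
    (M : G.Hor a b) (M' : G.Hor a' b') (N : G.Hor b c) (N' : G.Hor b' c')
    (P : G.Hor c d) (P' : G.Hor c' d'),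
    vcomp (hcompSq (chi M M' N N') (vid (tensorHor P P')))
        (vcomp (chi (hcomp M N) (hcomp M' N') P P') (tensorSq (assoc M N P) (assoc M' N' P'))) ≗
      vcomp (assoc (tensorHor M M') (tensorHor N N') (tensorHor P P'))
        (vcomp (hcompSq (vid (tensorHor M M')) (chi N N' P P'))
          (chi M M' (hcomp N P) (hcomp N' P')))
  chi_leftUnitor : ∀ {a b a' b' : G.Obj} (M : G.Hor a b) (M' : G.Hor a' b'),
    vcomp (hcompSq (mu a a') (vid (tensorHor M M')))
        (vcomp (chi (hid a) (hid a') M M') (tensorSq (leftUnitor M) (leftUnitor M'))) ≗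
      leftUnitor (tensorHor M M')
  chi_rightUnitor : ∀ {a b a' b' : G.Obj} (M : G.Hor a b) (M' : G.Hor a' b'),
    vcomp (hcompSq (vid (tensorHor M M')) (mu b b'))
        (vcomp (chi M M' (hid b) (hid b')) (tensorSq (rightUnitor M) (rightUnitor M'))) ≗
      rightUnitor (tensorHor M M')
  /- The associator of `⊗` is a transformation of double functors. -/
  tensorAssoc_hcomp : ∀ {a b c a' b' c' a'' b'' c'' : G.Obj}
    (M : G.Hor a b) (M' : G.Hor a' b') (M'' : G.Hor a'' b'')
    (N : G.Hor b c) (N' : G.Hor b' c') (N'' : G.Hor b'' c''),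
    vcomp (chi (tensorHor M M') M'' (tensorHor N N') N'')
        (vcomp (tensorSq (chi M M' N N') (vid (hcomp M'' N'')))
          (tensorAssoc (hcomp M N) (hcomp M' N') (hcomp M'' N''))) ≗
      vcomp (hcompSq (tensorAssoc M M' M'') (tensorAssoc N N' N''))
        (vcomp (chi M (tensorHor M' M'') N (tensorHor N' N''))
          (tensorSq (vid (hcomp M N)) (chi M' M'' N' N'')))
  tensorAssoc_hid : ∀ a b c : G.Obj,
    vcomp (mu (a ⊗ b) c)
        (vcomp (tensorSq (mu a b) (vid (hid c))) (tensorAssoc (hid a) (hid b) (hid c))) ≗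
      vcomp (hidSq (α_ a b c).hom)
        (vcomp (mu a (b ⊗ c)) (tensorSq (vid (hid a)) (mu b c)))
  /- The unitors of `⊗` are transformations of double functors.  The composition comparison of the
  unit double functor is the unitor `U I ⊙ U I ⟶ U I`. -/
  tensorLeftUnitor_hcomp : ∀ {a b c : G.Obj} (M : G.Hor a b) (N : G.Hor b c),
    vcomp (chi (hid (𝟙_ G.Obj)) M (hid (𝟙_ G.Obj)) N)
        (vcomp (tensorSq (leftUnitor (hid (𝟙_ G.Obj))) (vid (hcomp M N)))
          (tensorLeftUnitor (hcomp M N))) ≗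
      hcompSq (tensorLeftUnitor M) (tensorLeftUnitor N)
  tensorLeftUnitor_hid : ∀ a : G.Obj,
    vcomp (mu (𝟙_ G.Obj) a) (tensorLeftUnitor (hid a)) ≗ hidSq (λ_ a).hom
  tensorRightUnitor_hcomp : ∀ {a b c : G.Obj} (M : G.Hor a b) (N : G.Hor b c),
    vcomp (chi M (hid (𝟙_ G.Obj)) N (hid (𝟙_ G.Obj)))
        (vcomp (tensorSq (vid (hcomp M N)) (leftUnitor (hid (𝟙_ G.Obj))))
          (tensorRightUnitor (hcomp M N))) ≗
      hcompSq (tensorRightUnitor M) (tensorRightUnitor N)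
  tensorRightUnitor_hid : ∀ a : G.Obj,
    vcomp (mu a (𝟙_ G.Obj)) (tensorRightUnitor (hid a)) ≗ hidSq (ρ_ a).hom

/-- A symmetric monoidal double category. -/
structure SymmetricMonoidalDoubleCategory (G : DoubleCells.{u, v, w, z}) extends
    MonoidalDoubleCategory G where
  /-- The symmetry of `D₀`. -/
  [symmetric : SymmetricCategory G.Obj]
  /- The symmetry of `D₁`, over that of `D₀`. -/
  braid : ∀ {a b a' b' : G.Obj} (M : G.Hor a b) (M' : G.Hor a' b'),
    G.Sq (β_ a a').hom (β_ b b').hom (tensorHor M M') (tensorHor M' M)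
  braid_naturality : ∀ {a b c d a' b' c' d' : G.Obj}
    {f : a ⟶ c} {g : b ⟶ d} {f' : a' ⟶ c'} {g' : b' ⟶ d'}
    {M : G.Hor a b} {N : G.Hor c d} {M' : G.Hor a' b'} {N' : G.Hor c' d'}
    (α : G.Sq f g M N) (α' : G.Sq f' g' M' N'),
    vcomp (tensorSq α α') (braid N N') ≗ vcomp (braid M M') (tensorSq α' α)
  braid_braid : ∀ {a b a' b' : G.Obj} (M : G.Hor a b) (M' : G.Hor a' b'),
    vcomp (braid M M') (braid M' M) ≗ vid (tensorHor M M')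
  hexagon_forward : ∀ {a b a' b' a'' b'' : G.Obj}
    (M : G.Hor a b) (M' : G.Hor a' b') (M'' : G.Hor a'' b''),
    vcomp (tensorAssoc M M' M'')
        (vcomp (braid M (tensorHor M' M'')) (tensorAssoc M' M'' M)) ≗
      vcomp (tensorSq (braid M M') (vid M''))
        (vcomp (tensorAssoc M' M M'') (tensorSq (vid M') (braid M M'')))
  hexagon_reverse : ∀ {a b a' b' a'' b'' : G.Obj}
    (M : G.Hor a b) (M' : G.Hor a' b') (M'' : G.Hor a'' b''),
    vcomp (tensorAssocInv M M' M'')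
        (vcomp (braid (tensorHor M M') M'') (tensorAssocInv M'' M M')) ≗
      vcomp (tensorSq (vid M) (braid M' M''))
        (vcomp (tensorAssocInv M M'' M') (tensorSq (braid M M'') (vid M')))
  /- The symmetry is a transformation of double functors. -/
  braid_hcomp : ∀ {a b c a' b' c' : G.Obj}
    (M : G.Hor a b) (M' : G.Hor a' b') (N : G.Hor b c) (N' : G.Hor b' c'),
    vcomp (chi M M' N N') (braid (hcomp M N) (hcomp M' N')) ≗
      vcomp (hcompSq (braid M M') (braid N N')) (chi M' M N' N)
  braid_hid : ∀ a b : G.Obj,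
    vcomp (mu a b) (braid (hid a) (hid b)) ≗ vcomp (hidSq (β_ a b).hom) (mu b a)

namespace SymmetricMonoidalDoubleCategory

/-! The monoidal structure on the vertical category `D₀` of `D`. -/

variable {G : DoubleCells.{u, v, w, z}} (D : SymmetricMonoidalDoubleCategory G)

/-- The unit object of `D`. -/
def unitObj : G.Obj := D.monoidal.tensorUnit

/-- The tensor product of objects of `D`. -/
def tensorObj (a b : G.Obj) : G.Obj := D.monoidal.tensorObj a b

/-- The tensor product of vertical 1-morphisms of `D`. -/
def tensorMap {a b a' b' : G.Obj} (f : a ⟶ b) (f' : a' ⟶ b') :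
    D.tensorObj a a' ⟶ D.tensorObj b b' :=
  D.monoidal.tensorHom f f'

/-- The associator of the tensor product of objects of `D`. -/
def assocObj (a b c : G.Obj) :
    D.tensorObj (D.tensorObj a b) c ⟶ D.tensorObj a (D.tensorObj b c) :=
  (D.monoidal.associator a b c).hom

/-- The left unitor of the tensor product of objects of `D`. -/
def leftUnitorObj (a : G.Obj) : D.tensorObj D.unitObj a ⟶ a :=
  (D.monoidal.leftUnitor a).hom

/-- The right unitor of the tensor product of objects of `D`. -/
def rightUnitorObj (a : G.Obj) : D.tensorObj a D.unitObj ⟶ a :=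
  (D.monoidal.rightUnitor a).hom

/-- The symmetry of the tensor product of objects of `D`. -/
def braidObj (a b : G.Obj) : D.tensorObj a b ⟶ D.tensorObj b a :=
  (D.symmetric.braiding a b).hom

end SymmetricMonoidalDoubleCategory

/-! ## Petri nets -/

/-- A Petri net: sets `T` of transitions and `S` of places, with source and target functions
`s, t : T → ℕ[S]`, where `ℕ[S] = S →₀ ℕ` is the free commutative monoid on `S`. -/
structure Petri where
  T : Type u
  S : Type u
  s : T → (S →₀ ℕ)
  t : T → (S →₀ ℕ)

namespace Petri

/-- A morphism of Petri nets. -/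
@[ext]
structure Hom (P Q : Petri.{u}) where
  onT : P.T → Q.T
  onS : P.S → Q.S
  source_comm : ∀ τ, Q.s (onT τ) = (P.s τ).mapDomain onS
  target_comm : ∀ τ, Q.t (onT τ) = (P.t τ).mapDomain onS

/-- The category of Petri nets. -/
instance : Category Petri.{u} where
  Hom := Hom
  id P := ⟨id, id, fun τ => by simp [Finsupp.mapDomain_id], fun τ => by simp [Finsupp.mapDomain_id]⟩
  comp f g := ⟨g.onT ∘ f.onT, g.onS ∘ f.onS,
    fun τ => by simp [g.source_comm, f.source_comm, Finsupp.mapDomain_comp],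
    fun τ => by simp [g.target_comm, f.target_comm, Finsupp.mapDomain_comp]⟩

/-- The functor `L : Set ⥤ Petri` sending a set `X` to the Petri net with `X` as set of places and
no transitions. -/
def L : Type u ⥤ Petri.{u} where
  obj X := ⟨PEmpty, X, PEmpty.elim, PEmpty.elim⟩
  map f := ⟨id, f, fun τ => τ.elim, fun τ => τ.elim⟩

end Petri

/-- An open Petri net from `X` to `Y`: a cospan `L X ⟶ P ⟵ L Y` of Petri nets. -/
structure OpenPetri (X Y : Type u) where
  apex : Petri.{u}
  i : Petri.L.obj X ⟶ apex
  o : Petri.L.obj Y ⟶ apex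

/-- A 2-morphism of open Petri nets over functions `f` and `g`: a map `α` of Petri nets making
```
      L X --i--> P <--o-- L Y
       |         |         |
      L f        α        L g
       v         v         v
      L X' -i'-> P' <-o'- L Y'
```
commute. -/
@[ext]
structure OpenPetri.Hom {X Y X' Y' : Type u} (f : X ⟶ X') (g : Y ⟶ Y')
    (P : OpenPetri X Y) (P' : OpenPetri X' Y') where
  apex : P.apex ⟶ P'.apex
  comm_i : P.i ≫ apex = Petri.L.map f ≫ P'.i
  comm_o : P.o ≫ apex = Petri.L.map g ≫ P'.o

/-- The cells of the double category of open Petri nets: sets, functions, open Petri nets, and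
maps of cospans. -/
abbrev openPetriCells : DoubleCells.{u + 1, u, u + 1, u} where
  Obj := Type u
  Hor X Y := OpenPetri X Y
  Sq f g P P' := OpenPetri.Hom f g P P'

/-- The description of the compositions, the tensor product and the coherence cells of the symmetric
monoidal double category of open Petri nets, in terms of compositions, pushouts and coproducts. -/
structure OpenPetriDescription (D : SymmetricMonoidalDoubleCategory openPetriCells.{u}) where
  /- Vertical composition of 2-morphisms is composition in `Petri`. -/
  vid_apex : ∀ {X Y : Type u} (P : OpenPetri X Y), OpenPetri.Hom.apex (D.vid P) = 𝟙 P.apex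
  vcomp_apex : ∀ {X Y X' Y' X'' Y'' : Type u} {f : X ⟶ X'} {g : Y ⟶ Y'} {f' : X' ⟶ X''}
    {g' : Y' ⟶ Y''} {P : OpenPetri X Y} {P' : OpenPetri X' Y'} {P'' : OpenPetri X'' Y''}
    (α : OpenPetri.Hom f g P P') (α' : OpenPetri.Hom f' g' P' P''),
    OpenPetri.Hom.apex (D.vcomp α α') = α.apex ≫ α'.apex
  /- Identity horizontal 1-cells are identity cospans. -/
  hid_eq : ∀ X : Type u, D.hid X = OpenPetri.mk (Petri.L.obj X) (𝟙 _) (𝟙 _)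
  /- Horizontal composition is by pushout, with coprojections `jl` and `jr`. -/
  jl : ∀ {X Y Z : Type u} (P : OpenPetri X Y) (Q : OpenPetri Y Z),
    P.apex ⟶ OpenPetri.apex (D.hcomp P Q)
  jr : ∀ {X Y Z : Type u} (P : OpenPetri X Y) (Q : OpenPetri Y Z),
    Q.apex ⟶ OpenPetri.apex (D.hcomp P Q)
  isPushout : ∀ {X Y Z : Type u} (P : OpenPetri X Y) (Q : OpenPetri Y Z),
    IsPushout P.o Q.i (jl P Q) (jr P Q)
  hcomp_i : ∀ {X Y Z : Type u} (P : OpenPetri X Y) (Q : OpenPetri Y Z),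
    OpenPetri.i (D.hcomp P Q) = P.i ≫ jl P Q
  hcomp_o : ∀ {X Y Z : Type u} (P : OpenPetri X Y) (Q : OpenPetri Y Z),
    OpenPetri.o (D.hcomp P Q) = Q.o ≫ jr P Q
  jl_hcompSq : ∀ {X Y Z X' Y' Z' : Type u} {f : X ⟶ X'} {g : Y ⟶ Y'} {h : Z ⟶ Z'}
    {P : OpenPetri X Y} {Q : OpenPetri Y Z} {P' : OpenPetri X' Y'} {Q' : OpenPetri Y' Z'}
    (α : OpenPetri.Hom f g P P') (β : OpenPetri.Hom g h Q Q'),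
    jl P Q ≫ OpenPetri.Hom.apex (D.hcompSq α β) = α.apex ≫ jl P' Q'
  jr_hcompSq : ∀ {X Y Z X' Y' Z' : Type u} {f : X ⟶ X'} {g : Y ⟶ Y'} {h : Z ⟶ Z'}
    {P : OpenPetri X Y} {Q : OpenPetri Y Z} {P' : OpenPetri X' Y'} {Q' : OpenPetri Y' Z'}
    (α : OpenPetri.Hom f g P P') (β : OpenPetri.Hom g h Q Q'),
    jr P Q ≫ OpenPetri.Hom.apex (D.hcompSq α β) = β.apex ≫ jr P' Q'
  /- The associator and the unitors are the canonical maps between pushouts. -/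
  jl_jl_assoc : ∀ {X Y Z W : Type u} (P : OpenPetri X Y) (Q : OpenPetri Y Z) (R : OpenPetri Z W),
    jl P Q ≫ jl (D.hcomp P Q) R ≫ OpenPetri.Hom.apex (D.assoc P Q R) = jl P (D.hcomp Q R)
  jr_jl_assoc : ∀ {X Y Z W : Type u} (P : OpenPetri X Y) (Q : OpenPetri Y Z) (R : OpenPetri Z W),
    jr P Q ≫ jl (D.hcomp P Q) R ≫ OpenPetri.Hom.apex (D.assoc P Q R) =
      jl Q R ≫ jr P (D.hcomp Q R)
  jr_assoc : ∀ {X Y Z W : Type u} (P : OpenPetri X Y) (Q : OpenPetri Y Z) (R : OpenPetri Z W),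
    jr (D.hcomp P Q) R ≫ OpenPetri.Hom.apex (D.assoc P Q R) = jr Q R ≫ jr P (D.hcomp Q R)
  jr_leftUnitor : ∀ {X Y : Type u} (P : OpenPetri X Y),
    jr (D.hid X) P ≫ OpenPetri.Hom.apex (D.leftUnitor P) = 𝟙 P.apex
  jl_rightUnitor : ∀ {X Y : Type u} (P : OpenPetri X Y),
    jl P (D.hid Y) ≫ OpenPetri.Hom.apex (D.rightUnitor P) = 𝟙 P.apex
  /- On sets, the tensor product is the coproduct, with coprojections `inl` and `inr`, and the unit
  is the empty set. -/
  isInitial : IsInitial (C := Type u) D.unitObj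
  inl : ∀ X Y : Type u, X ⟶ D.tensorObj X Y
  inr : ∀ X Y : Type u, Y ⟶ D.tensorObj X Y
  isCoproduct : ∀ X Y : Type u, IsColimit (BinaryCofan.mk (inl X Y) (inr X Y))
  inl_tensorMap : ∀ {X Y X' Y' : Type u} (f : X ⟶ X') (g : Y ⟶ Y'),
    inl X Y ≫ D.tensorMap f g = f ≫ inl X' Y'
  inr_tensorMap : ∀ {X Y X' Y' : Type u} (f : X ⟶ X') (g : Y ⟶ Y'),
    inr X Y ≫ D.tensorMap f g = g ≫ inr X' Y'
  inl_inl_assocObj : ∀ X Y Z : Type u,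
    inl X Y ≫ inl (D.tensorObj X Y) Z ≫ D.assocObj X Y Z = inl X (D.tensorObj Y Z)
  inr_inl_assocObj : ∀ X Y Z : Type u,
    inr X Y ≫ inl (D.tensorObj X Y) Z ≫ D.assocObj X Y Z = inl Y Z ≫ inr X (D.tensorObj Y Z)
  inr_assocObj : ∀ X Y Z : Type u,
    inr (D.tensorObj X Y) Z ≫ D.assocObj X Y Z = inr Y Z ≫ inr X (D.tensorObj Y Z)
  inr_leftUnitorObj : ∀ X : Type u, inr D.unitObj X ≫ D.leftUnitorObj X = 𝟙 X
  inl_rightUnitorObj : ∀ X : Type u, inl X D.unitObj ≫ D.rightUnitorObj X = 𝟙 X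
  inl_braidObj : ∀ X Y : Type u, inl X Y ≫ D.braidObj X Y = inr Y X
  inr_braidObj : ∀ X Y : Type u, inr X Y ≫ D.braidObj X Y = inl Y X
  /- On open Petri nets, the tensor product is the coproduct in `Petri`, with coprojections `kl` and
  `kr`. -/
  kl : ∀ {X Y X' Y' : Type u} (P : OpenPetri X Y) (P' : OpenPetri X' Y'),
    P.apex ⟶ OpenPetri.apex (D.tensorHor P P')
  kr : ∀ {X Y X' Y' : Type u} (P : OpenPetri X Y) (P' : OpenPetri X' Y'),
    P'.apex ⟶ OpenPetri.apex (D.tensorHor P P')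
  isCoproduct_apex : ∀ {X Y X' Y' : Type u} (P : OpenPetri X Y) (P' : OpenPetri X' Y'),
    IsColimit (BinaryCofan.mk (kl P P') (kr P P'))
  inl_tensorHor_i : ∀ {X Y X' Y' : Type u} (P : OpenPetri X Y) (P' : OpenPetri X' Y'),
    Petri.L.map (inl X X') ≫ OpenPetri.i (D.tensorHor P P') = P.i ≫ kl P P'
  inr_tensorHor_i : ∀ {X Y X' Y' : Type u} (P : OpenPetri X Y) (P' : OpenPetri X' Y'),
    Petri.L.map (inr X X') ≫ OpenPetri.i (D.tensorHor P P') = P'.i ≫ kr P P'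
  inl_tensorHor_o : ∀ {X Y X' Y' : Type u} (P : OpenPetri X Y) (P' : OpenPetri X' Y'),
    Petri.L.map (inl Y Y') ≫ OpenPetri.o (D.tensorHor P P') = P.o ≫ kl P P'
  inr_tensorHor_o : ∀ {X Y X' Y' : Type u} (P : OpenPetri X Y) (P' : OpenPetri X' Y'),
    Petri.L.map (inr Y Y') ≫ OpenPetri.o (D.tensorHor P P') = P'.o ≫ kr P P'
  kl_tensorSq : ∀ {X Y X' Y' X₁ Y₁ X₁' Y₁' : Type u}
    {f : X ⟶ X₁} {g : Y ⟶ Y₁} {f' : X' ⟶ X₁'} {g' : Y' ⟶ Y₁'}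
    {P : OpenPetri X Y} {P' : OpenPetri X' Y'} {Q : OpenPetri X₁ Y₁} {Q' : OpenPetri X₁' Y₁'}
    (α : OpenPetri.Hom f g P Q) (α' : OpenPetri.Hom f' g' P' Q'),
    kl P P' ≫ OpenPetri.Hom.apex (D.tensorSq α α') = α.apex ≫ kl Q Q'
  kr_tensorSq : ∀ {X Y X' Y' X₁ Y₁ X₁' Y₁' : Type u}
    {f : X ⟶ X₁} {g : Y ⟶ Y₁} {f' : X' ⟶ X₁'} {g' : Y' ⟶ Y₁'}
    {P : OpenPetri X Y} {P' : OpenPetri X' Y'} {Q : OpenPetri X₁ Y₁} {Q' : OpenPetri X₁' Y₁'}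
    (α : OpenPetri.Hom f g P Q) (α' : OpenPetri.Hom f' g' P' Q'),
    kr P P' ≫ OpenPetri.Hom.apex (D.tensorSq α α') = α'.apex ≫ kr Q Q'
  /- The coherence cells of the tensor product are the canonical maps. -/
  kl_kl_tensorAssoc : ∀ {X Y X' Y' X'' Y'' : Type u}
    (P : OpenPetri X Y) (P' : OpenPetri X' Y') (P'' : OpenPetri X'' Y''),
    kl P P' ≫ kl (D.tensorHor P P') P'' ≫ OpenPetri.Hom.apex (D.tensorAssoc P P' P'') =
      kl P (D.tensorHor P' P'')
  kr_kl_tensorAssoc : ∀ {X Y X' Y' X'' Y'' : Type u}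
    (P : OpenPetri X Y) (P' : OpenPetri X' Y') (P'' : OpenPetri X'' Y''),
    kr P P' ≫ kl (D.tensorHor P P') P'' ≫ OpenPetri.Hom.apex (D.tensorAssoc P P' P'') =
      kl P' P'' ≫ kr P (D.tensorHor P' P'')
  kr_tensorAssoc : ∀ {X Y X' Y' X'' Y'' : Type u}
    (P : OpenPetri X Y) (P' : OpenPetri X' Y') (P'' : OpenPetri X'' Y''),
    kr (D.tensorHor P P') P'' ≫ OpenPetri.Hom.apex (D.tensorAssoc P P' P'') =
      kr P' P'' ≫ kr P (D.tensorHor P' P'')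
  kr_tensorLeftUnitor : ∀ {X Y : Type u} (P : OpenPetri X Y),
    kr (D.hid D.unitObj) P ≫ OpenPetri.Hom.apex (D.tensorLeftUnitor P) = 𝟙 P.apex
  kl_tensorRightUnitor : ∀ {X Y : Type u} (P : OpenPetri X Y),
    kl P (D.hid D.unitObj) ≫ OpenPetri.Hom.apex (D.tensorRightUnitor P) = 𝟙 P.apex
  kl_braid : ∀ {X Y X' Y' : Type u} (P : OpenPetri X Y) (P' : OpenPetri X' Y'),
    kl P P' ≫ OpenPetri.Hom.apex (D.braid P P') = kr P' P
  kr_braid : ∀ {X Y X' Y' : Type u} (P : OpenPetri X Y) (P' : OpenPetri X' Y'),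
    kr P P' ≫ OpenPetri.Hom.apex (D.braid P P') = kl P' P
  kl_jl_chi : ∀ {X Y Z X' Y' Z' : Type u} (P : OpenPetri X Y) (P' : OpenPetri X' Y')
    (Q : OpenPetri Y Z) (Q' : OpenPetri Y' Z'),
    kl P P' ≫ jl (D.tensorHor P P') (D.tensorHor Q Q') ≫ OpenPetri.Hom.apex (D.chi P P' Q Q') =
      jl P Q ≫ kl (D.hcomp P Q) (D.hcomp P' Q')
  kr_jl_chi : ∀ {X Y Z X' Y' Z' : Type u} (P : OpenPetri X Y) (P' : OpenPetri X' Y')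
    (Q : OpenPetri Y Z) (Q' : OpenPetri Y' Z'),
    kr P P' ≫ jl (D.tensorHor P P') (D.tensorHor Q Q') ≫ OpenPetri.Hom.apex (D.chi P P' Q Q') =
      jl P' Q' ≫ kr (D.hcomp P Q) (D.hcomp P' Q')
  kl_jr_chi : ∀ {X Y Z X' Y' Z' : Type u} (P : OpenPetri X Y) (P' : OpenPetri X' Y')
    (Q : OpenPetri Y Z) (Q' : OpenPetri Y' Z'),
    kl Q Q' ≫ jr (D.tensorHor P P') (D.tensorHor Q Q') ≫ OpenPetri.Hom.apex (D.chi P P' Q Q') =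
      jr P Q ≫ kl (D.hcomp P Q) (D.hcomp P' Q')
  kr_jr_chi : ∀ {X Y Z X' Y' Z' : Type u} (P : OpenPetri X Y) (P' : OpenPetri X' Y')
    (Q : OpenPetri Y Z) (Q' : OpenPetri Y' Z'),
    kr Q Q' ≫ jr (D.tensorHor P P') (D.tensorHor Q Q') ≫ OpenPetri.Hom.apex (D.chi P P' Q Q') =
      jr P' Q' ≫ kr (D.hcomp P Q) (D.hcomp P' Q')

/-! The feet of the cospans are nets without transitions, so gluing takes place on places only: the
pushout of `P` and `Q` along `L Y` has the disjoint union of their transitions and the pushout of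
their sets of places. Sources and targets extend to it because ℕ[-] is a functor (`mapDomain_eq`).
The universal properties of this model and of the disjoint union are `glue_isPushout` and
`sumIsColimit`.

All structure cells are canonical maps out of iterated pushouts and coproducts, so each axiom
compares two maps out of such a colimit and only has to be checked on the coprojections;
`glue_hom_ext` and `sum_hom_ext` make this reduction. Copairings are built from `Sum.elim` and
`Quot.lift`, which compute on coprojections, so most restricted equations hold by `rfl`. The
exceptions are pieces of the form `L X` coming from horizontal identities. There maps are compared
on places (`hom_ext_of_places`), with the gluing relation `glue_sound` or the leg condition of a
2-morphism as input where needed; for the empty unit nothing is left to compare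
(`hom_ext_of_empty`).

Invertibility of a cell over isomorphisms reduces to that of its apex map (`isInvertible_of_isIso`).
The comparison `chi` is invertible because coproducts commute with pushouts, and `mu` because `L`
preserves binary coproducts. -/

noncomputable section

/-! ## Coproducts of Petri nets, and pushouts along nets without transitions -/

namespace Petri

/-- Functoriality of ℕ[-], with the factorization assumed pointwise so that `rfl` supplies it when
`g` is a copairing and `f` a coprojection. -/
theorem mapDomain_eq {A B C : Type u} {f : A → B} {g : B → C} {h : A → C} {v : A →₀ ℕ}
    (w : ∀ a, h a = g (f a)) : v.mapDomain h = (v.mapDomain f).mapDomain g := by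
  rw [← Finsupp.mapDomain_comp, funext w, Function.comp_def]

theorem hom_ext {P Q : Petri.{u}} {f g : P ⟶ Q} (hT : ∀ τ, Hom.onT f τ = Hom.onT g τ)
    (hS : ∀ x, Hom.onS f x = Hom.onS g x) : f = g :=
  Hom.ext (funext hT) (funext hS)

theorem congr_onS {P Q : Petri.{u}} {f g : P ⟶ Q} (h : f = g) (x : P.S) :
    Hom.onS f x = Hom.onS g x := by
  rw [h]

theorem congr_onT {P Q : Petri.{u}} {f g : P ⟶ Q} (h : f = g) (τ : P.T) :
    Hom.onT f τ = Hom.onT g τ := by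
  rw [h]

/-- `L.obj X` has no transitions, so the transition components agree vacuously. They need not agree
definitionally, which is why some equations below need this lemma and not just `rfl`. -/
theorem hom_ext_of_places {X : Type u} {P : Petri.{u}} {f g : L.obj X ⟶ P}
    (h : ∀ x : X, Hom.onS f x = Hom.onS g x) : f = g :=
  hom_ext (fun τ => PEmpty.elim τ) h

/-- The map out of a net without transitions given by a function on places. -/
def ofPlaces {X : Type u} {P : Petri.{u}} (g : X → P.S) : L.obj X ⟶ P :=
  Hom.mk PEmpty.elim g (fun τ => PEmpty.elim τ) (fun τ => PEmpty.elim τ)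

/-! ### Binary coproducts of Petri nets -/

/-- The coproduct of two Petri nets. -/
def sum (P Q : Petri.{u}) : Petri.{u} where
  T := P.T ⊕ Q.T
  S := P.S ⊕ Q.S
  s := Sum.elim (fun τ => (P.s τ).mapDomain Sum.inl) (fun τ => (Q.s τ).mapDomain Sum.inr)
  t := Sum.elim (fun τ => (P.t τ).mapDomain Sum.inl) (fun τ => (Q.t τ).mapDomain Sum.inr)

/-- The left coprojection. -/
def sumInl (P Q : Petri.{u}) : P ⟶ sum P Q :=
  Hom.mk Sum.inl Sum.inl (fun _ => rfl) (fun _ => rfl)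

/-- The right coprojection. -/
def sumInr (P Q : Petri.{u}) : Q ⟶ sum P Q :=
  Hom.mk Sum.inr Sum.inr (fun _ => rfl) (fun _ => rfl)

/-- The map out of a coproduct given by maps out of the summands. -/
def sumDesc {P Q R : Petri.{u}} (f : P ⟶ R) (g : Q ⟶ R) : sum P Q ⟶ R :=
  Hom.mk (Sum.elim (Hom.onT f) (Hom.onT g)) (Sum.elim (Hom.onS f) (Hom.onS g))
    (by
      rintro (τ | τ)
      · exact (Hom.source_comm f τ).trans (mapDomain_eq fun _ => rfl)
      · exact (Hom.source_comm g τ).trans (mapDomain_eq fun _ => rfl))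
    (by
      rintro (τ | τ)
      · exact (Hom.target_comm f τ).trans (mapDomain_eq fun _ => rfl)
      · exact (Hom.target_comm g τ).trans (mapDomain_eq fun _ => rfl))

/-- The coproduct of two maps of Petri nets. -/
def sumMap {P Q P' Q' : Petri.{u}} (f : P ⟶ P') (g : Q ⟶ Q') : sum P Q ⟶ sum P' Q' :=
  sumDesc (f ≫ sumInl P' Q') (g ≫ sumInr P' Q')

theorem sum_hom_ext {P Q R : Petri.{u}} {f g : sum P Q ⟶ R}
    (hl : sumInl P Q ≫ f = sumInl P Q ≫ g) (hr : sumInr P Q ≫ f = sumInr P Q ≫ g) : f = g := by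
  refine hom_ext ?_ ?_
  · rintro (τ | τ)
    · exact congr_onT hl τ
    · exact congr_onT hr τ
  · rintro (x | x)
    · exact congr_onS hl x
    · exact congr_onS hr x

/-- `sum P Q` is a coproduct of `P` and `Q`. -/
def sumIsColimit (P Q : Petri.{u}) : IsColimit (BinaryCofan.mk (sumInl P Q) (sumInr P Q)) :=
  BinaryCofan.IsColimit.mk _ (fun f g => sumDesc f g) (fun _ _ => rfl) (fun _ _ => rfl)
    (fun _ _ _ h₁ h₂ => sum_hom_ext h₁ h₂)

/-! ### Pushouts of Petri nets along a set of places -/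

/-- The relation that identifies the two images of every element of `X`. -/
inductive Glue {X A B : Type u} (o : X → A) (i : X → B) : A ⊕ B → A ⊕ B → Prop
  | glue (x : X) : Glue o i (Sum.inl (o x)) (Sum.inr (i x))

/-- The pushout of two Petri nets along a set of places. -/
def glue {X : Type u} {P Q : Petri.{u}} (o : L.obj X ⟶ P) (i : L.obj X ⟶ Q) : Petri.{u} where
  -- The common foot has no transitions, so none are identified.
  T := P.T ⊕ Q.T
  -- `Glue` is not an equivalence relation; `Quot` divides by the one it generates, and maps out
  -- need compatibility only on the generators.
  S := Quot (Glue (Hom.onS o) (Hom.onS i))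
  s := Sum.elim (fun τ => (P.s τ).mapDomain fun x => Quot.mk _ (Sum.inl x))
    (fun τ => (Q.s τ).mapDomain fun x => Quot.mk _ (Sum.inr x))
  t := Sum.elim (fun τ => (P.t τ).mapDomain fun x => Quot.mk _ (Sum.inl x))
    (fun τ => (Q.t τ).mapDomain fun x => Quot.mk _ (Sum.inr x))

section Glue

variable {X : Type u} {P Q : Petri.{u}} (o : L.obj X ⟶ P) (i : L.obj X ⟶ Q)

/-- The left coprojection to the pushout. -/
def glueInl : P ⟶ glue o i :=
  Hom.mk Sum.inl (fun x => Quot.mk _ (Sum.inl x)) (fun _ => rfl) (fun _ => rfl)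

/-- The right coprojection to the pushout. -/
def glueInr : Q ⟶ glue o i :=
  Hom.mk Sum.inr (fun x => Quot.mk _ (Sum.inr x)) (fun _ => rfl) (fun _ => rfl)

/-- The commuting pushout square, on places. It discharges the compatibility conditions of the
copairings that define the coherence cells and their inverses. -/
theorem glue_sound (x : X) :
    Hom.onS (glueInl o i) (Hom.onS o x) = Hom.onS (glueInr o i) (Hom.onS i x) :=
  Quot.sound (Glue.glue x)

variable {o i}

/-- The map out of a pushout given by maps that agree on the glued places. -/
def glueDesc {R : Petri.{u}} (f : P ⟶ R) (g : Q ⟶ R)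
    (h : ∀ x : X, Hom.onS f (Hom.onS o x) = Hom.onS g (Hom.onS i x)) : glue o i ⟶ R :=
  Hom.mk (Sum.elim (Hom.onT f) (Hom.onT g))
    (Quot.lift (Sum.elim (Hom.onS f) (Hom.onS g)) (by rintro _ _ ⟨x⟩; exact h x))
    (by
      rintro (τ | τ)
      · exact (Hom.source_comm f τ).trans (mapDomain_eq fun _ => rfl)
      · exact (Hom.source_comm g τ).trans (mapDomain_eq fun _ => rfl))
    (by
      rintro (τ | τ)
      · exact (Hom.target_comm f τ).trans (mapDomain_eq fun _ => rfl)
      · exact (Hom.target_comm g τ).trans (mapDomain_eq fun _ => rfl))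

theorem glue_hom_ext {R : Petri.{u}} {f g : glue o i ⟶ R}
    (hl : glueInl o i ≫ f = glueInl o i ≫ g) (hr : glueInr o i ≫ f = glueInr o i ≫ g) : f = g := by
  refine hom_ext ?_ ?_
  · rintro (τ | τ)
    · exact congr_onT hl τ
    · exact congr_onT hr τ
  · rintro ⟨x | x⟩
    · exact congr_onS hl x
    · exact congr_onS hr x

variable (o i)

theorem glue_isPushout : IsPushout o i (glueInl o i) (glueInr o i) where
  w := hom_ext_of_places (glue_sound o i)
  isColimit' :=
    ⟨PushoutCocone.IsColimit.mk _
      -- The cocone condition is an equation of maps out of `L.obj X`, so its content is the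
      -- equation on places.
      (fun s => glueDesc s.inl s.inr (congr_onS s.condition))
      (fun _ => rfl) (fun _ => rfl)
      (fun _ _ h₁ h₂ => glue_hom_ext h₁ h₂)⟩

end Glue

end Petri

/-! ## The double category of open Petri nets -/

namespace OpenPetri

open Petri

/-! ### 2-morphisms and their vertical composition -/

namespace Hom

variable {X Y X' Y' X'' Y'' : Type u} {f : X ⟶ X'} {g : Y ⟶ Y'} {f' : X' ⟶ X''} {g' : Y' ⟶ Y''}
  {P : OpenPetri X Y} {P' : OpenPetri X' Y'} {P'' : OpenPetri X'' Y''}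

theorem onS_i (α : Hom f g P P') (x : X) :
    Petri.Hom.onS α.apex (Petri.Hom.onS P.i x) = Petri.Hom.onS P'.i (f x) :=
  congr_onS α.comm_i x

theorem onS_o (α : Hom f g P P') (y : Y) :
    Petri.Hom.onS α.apex (Petri.Hom.onS P.o y) = Petri.Hom.onS P'.o (g y) :=
  congr_onS α.comm_o y

/-- A map of Petri nets that is compatible with the legs on places is a 2-morphism. -/
def ofPlaces (α : P.apex ⟶ P'.apex)
    (hi : ∀ x : X, Petri.Hom.onS α (Petri.Hom.onS P.i x) = Petri.Hom.onS P'.i (f x))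
    (ho : ∀ y : Y, Petri.Hom.onS α (Petri.Hom.onS P.o y) = Petri.Hom.onS P'.o (g y)) :
    Hom f g P P' :=
  ⟨α, hom_ext_of_places hi, hom_ext_of_places ho⟩

/-- The identity 2-morphism. -/
def vid (P : OpenPetri X Y) : Hom (𝟙 X) (𝟙 Y) P P :=
  ofPlaces (𝟙 _) (fun _ => rfl) (fun _ => rfl)

/-- Vertical composition of 2-morphisms. -/
def vcomp (α : Hom f g P P') (β : Hom f' g' P' P'') : Hom (f ≫ f') (g ≫ g') P P'' :=
  ofPlaces (α.apex ≫ β.apex)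
    (fun x => (congrArg (Petri.Hom.onS β.apex) (α.onS_i x)).trans (β.onS_i (f x)))
    (fun y => (congrArg (Petri.Hom.onS β.apex) (α.onS_o y)).trans (β.onS_o (g y)))

/-- Once the boundaries are identified, a 2-morphism is determined by its apex map, since the leg
conditions are propositions. The boundaries are compared pointwise because those of a coherence
equation may agree only after a case split on a disjoint union. -/
theorem sqEq {f₁ : X ⟶ X'} {g₁ : Y ⟶ Y'} {α : Hom f g P P'} {β : Hom f₁ g₁ P P'}
    (hf : ∀ x, f x = f₁ x) (hg : ∀ y, g y = g₁ y) (h : α.apex = β.apex) :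
    DoubleCells.SqEq (G := openPetriCells.{u}) α β := by
  obtain rfl : f = f₁ := by ext x; exact hf x
  obtain rfl : g = g₁ := by ext y; exact hg y
  obtain rfl : α = β := Hom.ext h
  rfl

end Hom

/-- Vertical composition of 2-morphisms of open Petri nets. -/
def vertical : VerticalStructure openPetriCells.{u} where
  vid := Hom.vid
  vcomp := Hom.vcomp
  vid_vcomp _ := Hom.sqEq (fun _ => rfl) (fun _ => rfl) rfl
  vcomp_vid _ := Hom.sqEq (fun _ => rfl) (fun _ => rfl) rfl
  vcomp_assoc _ _ _ := Hom.sqEq (fun _ => rfl) (fun _ => rfl) rfl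

/-- The inverses of the apex map and of the boundaries form a 2-morphism: inverting `α` and `L f` in
the leg condition of `α` gives the leg condition for the inverse. -/
theorem isInvertible_of_isIso {X Y X' Y' : Type u} {f : X ⟶ X'} {g : Y ⟶ Y'}
    {P : OpenPetri X Y} {P' : OpenPetri X' Y'} (α : Hom f g P P') [IsIso f] [IsIso g]
    [IsIso α.apex] : vertical.IsInvertible α := by
  refine ⟨inv f, inv g, ⟨inv α.apex, ?_, ?_⟩, ?_, ?_⟩
  · rw [IsIso.comp_inv_eq, Category.assoc, α.comm_i, ← Category.assoc, ← Functor.map_comp,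
      IsIso.inv_hom_id, CategoryTheory.Functor.map_id, Category.id_comp]
  · rw [IsIso.comp_inv_eq, Category.assoc, α.comm_o, ← Category.assoc, ← Functor.map_comp,
      IsIso.inv_hom_id, CategoryTheory.Functor.map_id, Category.id_comp]
  · exact Hom.sqEq
      (fun x => ConcreteCategory.congr_hom (IsIso.hom_inv_id f) x)
      (fun y => ConcreteCategory.congr_hom (IsIso.hom_inv_id g) y)
      (IsIso.hom_inv_id α.apex)
  · exact Hom.sqEq
      (fun x => ConcreteCategory.congr_hom (IsIso.inv_hom_id f) x)
      (fun y => ConcreteCategory.congr_hom (IsIso.inv_hom_id g) y)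
      (IsIso.inv_hom_id α.apex)

/-- The horizontal identity. -/
def hid (X : Type u) : OpenPetri X X := ⟨L.obj X, 𝟙 _, 𝟙 _⟩

/-- The horizontal identity 2-morphism on a function. -/
def hidSq {X Y : Type u} (f : X ⟶ Y) : Hom f f (hid X) (hid Y) :=
  Hom.ofPlaces (L.map f) (fun _ => rfl) (fun _ => rfl)

section HorizontalComposition

variable {X Y Z W : Type u}

/-- Horizontal composition of open Petri nets. -/
def hcomp (P : OpenPetri X Y) (Q : OpenPetri Y Z) : OpenPetri X Z :=
  ⟨glue P.o Q.i, P.i ≫ glueInl P.o Q.i, Q.o ≫ glueInr P.o Q.i⟩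

/-- Horizontal composition of 2-morphisms. -/
def hcompSq {X' Y' Z' : Type u} {f : X ⟶ X'} {g : Y ⟶ Y'} {h : Z ⟶ Z'}
    {P : OpenPetri X Y} {Q : OpenPetri Y Z} {P' : OpenPetri X' Y'} {Q' : OpenPetri Y' Z'}
    (α : Hom f g P P') (β : Hom g h Q Q') : Hom f h (hcomp P Q) (hcomp P' Q') :=
  Hom.ofPlaces
    -- On a glued place `y`, both sides are images of `g y`: move along the right leg of `α`, across
    -- the gluing of `P'` and `Q'`, and back along the left leg of `β`.
    (glueDesc (α.apex ≫ glueInl P'.o Q'.i) (β.apex ≫ glueInr P'.o Q'.i) fun y =>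
      (congrArg (Petri.Hom.onS (glueInl P'.o Q'.i)) (α.onS_o y)).trans
        ((glue_sound P'.o Q'.i (g y)).trans
          (congrArg (Petri.Hom.onS (glueInr P'.o Q'.i)) (β.onS_i y).symm)))
    (fun x => congrArg (Petri.Hom.onS (glueInl P'.o Q'.i)) (α.onS_i x))
    (fun z => congrArg (Petri.Hom.onS (glueInr P'.o Q'.i)) (β.onS_o z))

/-- The associator of horizontal composition. -/
def assoc (P : OpenPetri X Y) (Q : OpenPetri Y Z) (R : OpenPetri Z W) :
    Hom (𝟙 X) (𝟙 W) (hcomp (hcomp P Q) R) (hcomp P (hcomp Q R)) :=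
  Hom.ofPlaces
    (glueDesc (o := (hcomp P Q).o)
      (glueDesc (glueInl P.o (hcomp Q R).i) (glueInl Q.o R.i ≫ glueInr P.o (hcomp Q R).i)
        (glue_sound P.o (hcomp Q R).i))
      (glueInr Q.o R.i ≫ glueInr P.o (hcomp Q R).i)
      fun z => congrArg (Petri.Hom.onS (glueInr P.o (hcomp Q R).i)) (glue_sound Q.o R.i z))
    (fun _ => rfl) (fun _ => rfl)

instance isIso_assoc_apex (P : OpenPetri X Y) (Q : OpenPetri Y Z) (R : OpenPetri Z W) :
    IsIso (assoc P Q R).apex := by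
  -- The inverse is the canonical map in the other direction; both composites fix each of the three
  -- pieces `P`, `Q`, `R`.
  refine ⟨glueDesc (i := (hcomp Q R).i)
      (glueInl P.o Q.i ≫ glueInl (hcomp P Q).o R.i)
      (glueDesc (glueInr P.o Q.i ≫ glueInl (hcomp P Q).o R.i) (glueInr (hcomp P Q).o R.i)
        (glue_sound (hcomp P Q).o R.i))
      fun y => congrArg (Petri.Hom.onS (glueInl (hcomp P Q).o R.i)) (glue_sound P.o Q.i y),
    glue_hom_ext (glue_hom_ext rfl rfl) rfl, glue_hom_ext rfl (glue_hom_ext rfl rfl)⟩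

/-- The left unitor of horizontal composition. -/
def leftUnitor (P : OpenPetri X Y) : Hom (𝟙 X) (𝟙 Y) (hcomp (hid X) P) P :=
  Hom.ofPlaces (glueDesc P.i (𝟙 _) fun _ => rfl) (fun _ => rfl) (fun _ => rfl)

instance isIso_leftUnitor_apex (P : OpenPetri X Y) : IsIso (leftUnitor P).apex := by
  -- The inverse is the coprojection of `P`. The nontrivial check is on the piece `L X`: a place `x`
  -- comes back as the image of `P.i x`, which is glued to `x`.
  exact ⟨glueInr (hid X).o P.i, glue_hom_ext
    (hom_ext_of_places fun x => (glue_sound (hid X).o P.i x).symm) rfl, rfl⟩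

/-- The right unitor of horizontal composition. -/
def rightUnitor (P : OpenPetri X Y) : Hom (𝟙 X) (𝟙 Y) (hcomp P (hid Y)) P :=
  Hom.ofPlaces (glueDesc (𝟙 _) P.o fun _ => rfl) (fun _ => rfl) (fun _ => rfl)

instance isIso_rightUnitor_apex (P : OpenPetri X Y) : IsIso (rightUnitor P).apex := by
  exact ⟨glueInl P.o (hid Y).i, glue_hom_ext rfl
    (hom_ext_of_places fun x => glue_sound P.o (hid Y).i x), rfl⟩

end HorizontalComposition

/-- The double category of open Petri nets. -/
def double : DoubleCategory openPetriCells.{u} where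
  toVerticalStructure := vertical
  hid := hid
  hidSq := hidSq
  hidSq_id _ := rfl
  hidSq_comp _ _ := rfl
  hcomp := hcomp
  hcompSq := hcompSq
  hcompSq_vid _ _ := Hom.ext (glue_hom_ext rfl rfl)
  hcompSq_vcomp _ _ _ _ := Hom.ext (glue_hom_ext rfl rfl)
  assoc := assoc
  assoc_invertible P Q R := isInvertible_of_isIso (assoc P Q R)
  assoc_naturality _ _ _ :=
    Hom.sqEq (fun _ => rfl) (fun _ => rfl) (glue_hom_ext (glue_hom_ext rfl rfl) rfl)
  leftUnitor := leftUnitor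
  leftUnitor_invertible P := isInvertible_of_isIso (leftUnitor P)
  leftUnitor_naturality α :=
    -- Restricted to the identity cospan, naturality is exactly the left leg condition of `α`.
    Hom.sqEq (fun _ => rfl) (fun _ => rfl) (glue_hom_ext α.comm_i.symm rfl)
  rightUnitor := rightUnitor
  rightUnitor_invertible P := isInvertible_of_isIso (rightUnitor P)
  rightUnitor_naturality α :=
    Hom.sqEq (fun _ => rfl) (fun _ => rfl) (glue_hom_ext rfl α.comm_o.symm)
  pentagon _ _ _ _ :=
    Hom.sqEq (fun _ => rfl) (fun _ => rfl)
      (glue_hom_ext (glue_hom_ext (glue_hom_ext rfl rfl) rfl) rfl)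
  triangle P Q :=
    Hom.sqEq (fun _ => rfl) (fun _ => rfl)
      (glue_hom_ext
        -- The middle piece is `L Y`: one side sends its places through `Q.i`, the other through
        -- `P.o`, and these are glued in the composite.
        (glue_hom_ext rfl (hom_ext_of_places fun x => (glue_sound P.o Q.i x).symm)) rfl)

end OpenPetri

/-! ## Coproducts of sets as a symmetric monoidal structure -/

namespace SetSum

/-- The disjoint union of functions. -/
def map {X Y X' Y' : Type u} (f : X ⟶ Y) (g : X' ⟶ Y') : (X ⊕ X' : Type u) ⟶ (Y ⊕ Y' : Type u) :=
  ↾(Sum.map f g)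

/-- The associator of the disjoint union. -/
def assoc (X Y Z : Type u) : ((X ⊕ Y) ⊕ Z : Type u) ≅ (X ⊕ (Y ⊕ Z) : Type u) :=
  (Equiv.sumAssoc X Y Z).toIso

/-- The left unitor of the disjoint union. -/
def leftUnitor (X : Type u) : (PEmpty.{u + 1} ⊕ X : Type u) ≅ X :=
  (Equiv.emptySum PEmpty X).toIso

/-- The right unitor of the disjoint union. -/
def rightUnitor (X : Type u) : (X ⊕ PEmpty.{u + 1} : Type u) ≅ X :=
  (Equiv.sumEmpty X PEmpty).toIso

/-- The exchange of the summands of a disjoint union. -/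
def braiding (X Y : Type u) : (X ⊕ Y : Type u) ≅ (Y ⊕ X : Type u) :=
  (Equiv.sumComm X Y).toIso

/-- The monoidal structure on sets given by disjoint unions. -/
@[reducible]
def monoidal : MonoidalCategory (Type u) :=
  -- Kept local, so that the tensor of sets used here is not confused with the cartesian product.
  letI : MonoidalCategoryStruct (Type u) :=
    { tensorObj X Y := X ⊕ Y
      whiskerLeft X _ _ f := map (𝟙 X) f
      whiskerRight f Y := map f (𝟙 Y)
      tensorHom f g := map f g
      tensorUnit := PEmpty
      associator := assoc
      leftUnitor := leftUnitor
      rightUnitor := rightUnitor }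
  .ofTensorHom
    (id_tensorHom_id := fun _ _ => by ext (x | x) <;> rfl)
    (id_tensorHom := fun _ _ _ _ => rfl)
    (tensorHom_id := fun _ _ => rfl)
    (tensorHom_comp_tensorHom := fun _ _ _ _ => by ext (x | x) <;> rfl)
    (associator_naturality := fun _ _ _ => by ext ((x | x) | x) <;> rfl)
    (leftUnitor_naturality := fun _ => by ext (⟨⟨⟩⟩ | x); rfl)
    (rightUnitor_naturality := fun _ => by ext (x | ⟨⟨⟩⟩); rfl)
    (pentagon := fun _ _ _ _ => by ext (((x | x) | x) | x) <;> rfl)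
    (triangle := fun _ _ => by ext ((x | ⟨⟨⟩⟩) | x) <;> rfl)

/-- The symmetry of the disjoint union of sets. -/
@[reducible]
def symmetric : @SymmetricCategory (Type u) _ monoidal.{u} :=
  letI := monoidal.{u}
  { braiding := braiding
    braiding_naturality_right := fun _ _ _ _ => by ext (x | x) <;> rfl
    braiding_naturality_left := fun _ _ => by ext (x | x) <;> rfl
    hexagon_forward := fun _ _ _ => by ext ((x | x) | x) <;> rfl
    hexagon_reverse := fun _ _ _ => by ext (x | (x | x)) <;> rfl
    symmetry := fun _ _ => by ext (x | x) <;> rfl }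

end SetSum

/-! ## The symmetric monoidal structure on open Petri nets -/

namespace OpenPetri

open Petri

theorem hom_ext_of_empty {P : Petri.{u}} (f g : L.obj PEmpty.{u + 1} ⟶ P) : f = g :=
  hom_ext_of_places fun x => PEmpty.elim x

section Tensor

variable {X Y X' Y' X'' Y'' : Type u}

/-- The tensor product of open Petri nets. -/
def tensor (P : OpenPetri X Y) (P' : OpenPetri X' Y') : OpenPetri (X ⊕ X') (Y ⊕ Y') :=
  -- `L (X ⊕ X')` and the sum of `L X` and `L X'` have different, though both empty, types of
  -- transitions, so the legs are specified on places.
  ⟨sum P.apex P'.apex, ofPlaces (Sum.map (Petri.Hom.onS P.i) (Petri.Hom.onS P'.i)),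
    ofPlaces (Sum.map (Petri.Hom.onS P.o) (Petri.Hom.onS P'.o))⟩

/-- The tensor product of 2-morphisms. -/
def tensorSq {Z W Z' W' : Type u} {f : X ⟶ Z} {g : Y ⟶ W} {f' : X' ⟶ Z'} {g' : Y' ⟶ W'}
    {P : OpenPetri X Y} {Q : OpenPetri Z W} {P' : OpenPetri X' Y'} {Q' : OpenPetri Z' W'}
    (α : Hom f g P Q) (α' : Hom f' g' P' Q') :
    Hom (SetSum.map f f') (SetSum.map g g') (tensor P P') (tensor Q Q') :=
  Hom.ofPlaces (sumMap α.apex α'.apex)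
    (by
      rintro (x | x)
      · exact congrArg Sum.inl (α.onS_i x)
      · exact congrArg Sum.inr (α'.onS_i x))
    (by
      rintro (x | x)
      · exact congrArg Sum.inl (α.onS_o x)
      · exact congrArg Sum.inr (α'.onS_o x))

/-- The associator of the tensor product. -/
def tensorAssoc (P : OpenPetri X Y) (P' : OpenPetri X' Y') (P'' : OpenPetri X'' Y'') :
    Hom (SetSum.assoc X X' X'').hom (SetSum.assoc Y Y' Y'').hom
      (tensor (tensor P P') P'') (tensor P (tensor P' P'')) :=
  Hom.ofPlaces
    (sumDesc (sumDesc (sumInl _ _) (sumInl _ _ ≫ sumInr _ _)) (sumInr _ _ ≫ sumInr _ _))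
    (by rintro ((x | x) | x) <;> rfl) (by rintro ((x | x) | x) <;> rfl)

/-- The inverse of the associator of the tensor product. -/
def tensorAssocInv (P : OpenPetri X Y) (P' : OpenPetri X' Y') (P'' : OpenPetri X'' Y'') :
    Hom (SetSum.assoc X X' X'').inv (SetSum.assoc Y Y' Y'').inv
      (tensor P (tensor P' P'')) (tensor (tensor P P') P'') :=
  Hom.ofPlaces
    (sumDesc (sumInl _ _ ≫ sumInl _ _) (sumDesc (sumInr _ _ ≫ sumInl _ _) (sumInr _ _)))
    (by rintro (x | (x | x)) <;> rfl) (by rintro (x | (x | x)) <;> rfl)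

/-- The left unitor of the tensor product. -/
def tensorLeftUnitor (P : OpenPetri X Y) :
    Hom (SetSum.leftUnitor X).hom (SetSum.leftUnitor Y).hom (tensor (hid PEmpty) P) P :=
  Hom.ofPlaces (sumDesc (ofPlaces PEmpty.elim) (𝟙 _))
    (by rintro (⟨⟨⟩⟩ | x); rfl) (by rintro (⟨⟨⟩⟩ | x); rfl)

instance isIso_tensorLeftUnitor_apex (P : OpenPetri X Y) : IsIso (tensorLeftUnitor P).apex :=
  ⟨sumInr _ _, sum_hom_ext (hom_ext_of_empty _ _) rfl, rfl⟩

/-- The right unitor of the tensor product. -/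
def tensorRightUnitor (P : OpenPetri X Y) :
    Hom (SetSum.rightUnitor X).hom (SetSum.rightUnitor Y).hom (tensor P (hid PEmpty)) P :=
  Hom.ofPlaces (sumDesc (𝟙 _) (ofPlaces PEmpty.elim))
    (by rintro (x | ⟨⟨⟩⟩); rfl) (by rintro (x | ⟨⟨⟩⟩); rfl)

instance isIso_tensorRightUnitor_apex (P : OpenPetri X Y) : IsIso (tensorRightUnitor P).apex :=
  ⟨sumInl _ _, sum_hom_ext rfl (hom_ext_of_empty _ _), rfl⟩

/-- The symmetry of the tensor product. -/
def braid (P : OpenPetri X Y) (P' : OpenPetri X' Y') :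
    Hom (SetSum.braiding X X').hom (SetSum.braiding Y Y').hom (tensor P P') (tensor P' P) :=
  Hom.ofPlaces (sumDesc (sumInr _ _) (sumInl _ _))
    (by rintro (x | x) <;> rfl) (by rintro (x | x) <;> rfl)

/-- The comparison of the tensor product with horizontal composition. -/
def chi {Z Z' : Type u} (P : OpenPetri X Y) (P' : OpenPetri X' Y') (Q : OpenPetri Y Z)
    (Q' : OpenPetri Y' Z') :
    Hom (𝟙 _) (𝟙 _) (hcomp (tensor P P') (tensor Q Q')) (tensor (hcomp P Q) (hcomp P' Q')) :=
  Hom.ofPlaces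
    (glueDesc (o := (tensor P P').o) (i := (tensor Q Q').i)
      (sumMap (glueInl P.o Q.i) (glueInl P'.o Q'.i))
      (sumMap (glueInr P.o Q.i) (glueInr P'.o Q'.i))
      (by
        rintro (y | y)
        · exact congrArg Sum.inl (glue_sound P.o Q.i y)
        · exact congrArg Sum.inr (glue_sound P'.o Q'.i y)))
    (by rintro (x | x) <;> rfl) (by rintro (x | x) <;> rfl)

instance isIso_chi_apex {Z Z' : Type u} (P : OpenPetri X Y) (P' : OpenPetri X' Y')
    (Q : OpenPetri Y Z) (Q' : OpenPetri Y' Z') : IsIso (chi P P' Q Q').apex :=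
  -- The inverse sends each of the four pieces `P`, `Q`, `P'`, `Q'` to its copy in the pushout of
  -- sums. It is well defined because the gluing along `Y ⊕ Y'` restricts to the gluings along `Y`
  -- and `Y'`.
  ⟨sumDesc
      (glueDesc (sumInl _ _ ≫ glueInl (tensor P P').o (tensor Q Q').i)
        (sumInl _ _ ≫ glueInr (tensor P P').o (tensor Q Q').i)
        fun y => glue_sound (tensor P P').o (tensor Q Q').i (Sum.inl y))
      (glueDesc (sumInr _ _ ≫ glueInl (tensor P P').o (tensor Q Q').i)
        (sumInr _ _ ≫ glueInr (tensor P P').o (tensor Q Q').i)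
        fun y => glue_sound (tensor P P').o (tensor Q Q').i (Sum.inr y)),
    glue_hom_ext (sum_hom_ext rfl rfl) (sum_hom_ext rfl rfl),
    sum_hom_ext (glue_hom_ext rfl rfl) (glue_hom_ext rfl rfl)⟩

/-- The comparison of the tensor product with horizontal identities. -/
def mu (X Y : Type u) : Hom (𝟙 _) (𝟙 _) (hid (X ⊕ Y)) (tensor (hid X) (hid Y)) :=
  Hom.ofPlaces (ofPlaces id) (by rintro (x | x) <;> rfl) (by rintro (x | x) <;> rfl)

instance isIso_mu_apex (X Y : Type u) : IsIso (mu X Y).apex :=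
  -- The inverse is the canonical map from the sum of `L X` and `L Y` to `L (X ⊕ Y)`; both nets have
  -- the same places and no transitions.
  ⟨sumDesc (ofPlaces Sum.inl) (ofPlaces Sum.inr),
    hom_ext_of_places (by rintro (x | x) <;> rfl),
    sum_hom_ext (hom_ext_of_places fun _ => rfl) (hom_ext_of_places fun _ => rfl)⟩

end Tensor

/-! ### Verification of the monoidal and symmetry axioms -/

/-- The monoidal double category of open Petri nets. -/
def monoidalDouble : MonoidalDoubleCategory openPetriCells.{u} where
  toDoubleCategory := double
  monoidal := SetSum.monoidal
  tensorHor := tensor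
  tensorSq := tensorSq
  tensorSq_vid _ _ :=
    Hom.sqEq (by rintro (x | x) <;> rfl) (by rintro (x | x) <;> rfl) (sum_hom_ext rfl rfl)
  tensorSq_vcomp _ _ _ _ :=
    Hom.sqEq (by rintro (x | x) <;> rfl) (by rintro (x | x) <;> rfl) (sum_hom_ext rfl rfl)
  tensorAssoc := tensorAssoc
  tensorAssocInv := tensorAssocInv
  tensorAssoc_hom_inv _ _ _ :=
    Hom.sqEq (by rintro ((x | x) | x) <;> rfl) (by rintro ((x | x) | x) <;> rfl)
      (sum_hom_ext (sum_hom_ext rfl rfl) rfl)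
  tensorAssoc_inv_hom _ _ _ :=
    Hom.sqEq (by rintro (x | (x | x)) <;> rfl) (by rintro (x | (x | x)) <;> rfl)
      (sum_hom_ext rfl (sum_hom_ext rfl rfl))
  tensorAssoc_naturality _ _ _ :=
    Hom.sqEq (by rintro ((x | x) | x) <;> rfl) (by rintro ((x | x) | x) <;> rfl)
      (sum_hom_ext (sum_hom_ext rfl rfl) rfl)
  tensorLeftUnitor := tensorLeftUnitor
  tensorLeftUnitor_invertible P := isInvertible_of_isIso (tensorLeftUnitor P)
  tensorLeftUnitor_naturality _ :=
    Hom.sqEq (by rintro (⟨⟨⟩⟩ | x); rfl) (by rintro (⟨⟨⟩⟩ | x); rfl)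
      (sum_hom_ext (hom_ext_of_empty _ _) rfl)
  tensorRightUnitor := tensorRightUnitor
  tensorRightUnitor_invertible P := isInvertible_of_isIso (tensorRightUnitor P)
  tensorRightUnitor_naturality _ :=
    Hom.sqEq (by rintro (x | ⟨⟨⟩⟩); rfl) (by rintro (x | ⟨⟨⟩⟩); rfl)
      (sum_hom_ext rfl (hom_ext_of_empty _ _))
  tensor_pentagon _ _ _ _ :=
    Hom.sqEq (by rintro (((x | x) | x) | x) <;> rfl) (by rintro (((x | x) | x) | x) <;> rfl)
      (sum_hom_ext (sum_hom_ext (sum_hom_ext rfl rfl) rfl) rfl)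
  tensor_triangle _ _ :=
    Hom.sqEq (by rintro ((x | ⟨⟨⟩⟩) | x) <;> rfl) (by rintro ((x | ⟨⟨⟩⟩) | x) <;> rfl)
      (sum_hom_ext (sum_hom_ext rfl (hom_ext_of_empty _ _)) rfl)
  chi := chi
  chi_invertible P P' Q Q' := isInvertible_of_isIso (chi P P' Q Q')
  chi_naturality _ _ _ _ :=
    Hom.sqEq (by rintro (x | x) <;> rfl) (by rintro (x | x) <;> rfl)
      (glue_hom_ext (sum_hom_ext rfl rfl) (sum_hom_ext rfl rfl))
  mu := mu
  mu_invertible X Y := isInvertible_of_isIso (mu X Y)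
  mu_naturality _ _ :=
    Hom.sqEq (by rintro (x | x) <;> rfl) (by rintro (x | x) <;> rfl)
      (hom_ext_of_places (by rintro (x | x) <;> rfl))
  chi_assoc _ _ _ _ _ _ :=
    Hom.sqEq (by rintro (x | x) <;> rfl) (by rintro (x | x) <;> rfl)
      -- The source is a pushout of three sums, hence six pieces, each with a single canonical
      -- image.
      (glue_hom_ext (glue_hom_ext (sum_hom_ext rfl rfl) (sum_hom_ext rfl rfl))
        (sum_hom_ext rfl rfl))
  chi_leftUnitor _ _ :=
    Hom.sqEq (by rintro (x | x) <;> rfl) (by rintro (x | x) <;> rfl)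
      -- The first factor is the identity cospan on a disjoint union, not a sum of nets, so its
      -- piece is checked on places.
      (glue_hom_ext (hom_ext_of_places (by rintro (x | x) <;> rfl)) (sum_hom_ext rfl rfl))
  chi_rightUnitor _ _ :=
    Hom.sqEq (by rintro (x | x) <;> rfl) (by rintro (x | x) <;> rfl)
      (glue_hom_ext (sum_hom_ext rfl rfl) (hom_ext_of_places (by rintro (x | x) <;> rfl)))
  tensorAssoc_hcomp _ _ _ _ _ _ :=
    Hom.sqEq (by rintro ((x | x) | x) <;> rfl) (by rintro ((x | x) | x) <;> rfl)
      (glue_hom_ext (sum_hom_ext (sum_hom_ext rfl rfl) rfl)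
        (sum_hom_ext (sum_hom_ext rfl rfl) rfl))
  tensorAssoc_hid _ _ _ :=
    Hom.sqEq (by rintro ((x | x) | x) <;> rfl) (by rintro ((x | x) | x) <;> rfl)
      (hom_ext_of_places (by rintro ((x | x) | x) <;> rfl))
  tensorLeftUnitor_hcomp _ _ :=
    Hom.sqEq (by rintro (⟨⟨⟩⟩ | x); rfl) (by rintro (⟨⟨⟩⟩ | x); rfl)
      (glue_hom_ext (sum_hom_ext (hom_ext_of_empty _ _) rfl)
        (sum_hom_ext (hom_ext_of_empty _ _) rfl))
  tensorLeftUnitor_hid _ :=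
    Hom.sqEq (by rintro (⟨⟨⟩⟩ | x); rfl) (by rintro (⟨⟨⟩⟩ | x); rfl)
      (hom_ext_of_places (by rintro (⟨⟨⟩⟩ | x); rfl))
  tensorRightUnitor_hcomp _ _ :=
    Hom.sqEq (by rintro (x | ⟨⟨⟩⟩); rfl) (by rintro (x | ⟨⟨⟩⟩); rfl)
      (glue_hom_ext (sum_hom_ext rfl (hom_ext_of_empty _ _))
        (sum_hom_ext rfl (hom_ext_of_empty _ _)))
  tensorRightUnitor_hid _ :=
    Hom.sqEq (by rintro (x | ⟨⟨⟩⟩); rfl) (by rintro (x | ⟨⟨⟩⟩); rfl)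
      (hom_ext_of_places (by rintro (x | ⟨⟨⟩⟩); rfl))

/-- The symmetric monoidal double category of open Petri nets. -/
def symmetricMonoidalDouble : SymmetricMonoidalDoubleCategory openPetriCells.{u} where
  toMonoidalDoubleCategory := monoidalDouble
  symmetric := SetSum.symmetric
  braid := braid
  braid_naturality _ _ :=
    Hom.sqEq (by rintro (x | x) <;> rfl) (by rintro (x | x) <;> rfl) (sum_hom_ext rfl rfl)
  braid_braid _ _ :=
    Hom.sqEq (by rintro (x | x) <;> rfl) (by rintro (x | x) <;> rfl) (sum_hom_ext rfl rfl)
  hexagon_forward _ _ _ :=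
    Hom.sqEq (by rintro ((x | x) | x) <;> rfl) (by rintro ((x | x) | x) <;> rfl)
      (sum_hom_ext (sum_hom_ext rfl rfl) rfl)
  hexagon_reverse _ _ _ :=
    Hom.sqEq (by rintro (x | (x | x)) <;> rfl) (by rintro (x | (x | x)) <;> rfl)
      (sum_hom_ext rfl (sum_hom_ext rfl rfl))
  braid_hcomp _ _ _ _ :=
    Hom.sqEq (by rintro (x | x) <;> rfl) (by rintro (x | x) <;> rfl)
      (glue_hom_ext (sum_hom_ext rfl rfl) (sum_hom_ext rfl rfl))
  braid_hid _ _ :=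
    Hom.sqEq (by rintro (x | x) <;> rfl) (by rintro (x | x) <;> rfl)
      (hom_ext_of_places (by rintro (x | x) <;> rfl))

/-! ### Identification of the operations with pushouts and coproducts -/

/-- The operations of `symmetricMonoidalDouble` in terms of pushouts and coproducts. -/
def description : OpenPetriDescription symmetricMonoidalDouble.{u} where
  vid_apex _ := rfl
  vcomp_apex _ _ := rfl
  hid_eq _ := rfl
  jl P Q := glueInl P.o Q.i
  jr P Q := glueInr P.o Q.i
  isPushout P Q := glue_isPushout P.o Q.i
  hcomp_i _ _ := rfl
  hcomp_o _ _ := rfl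
  jl_hcompSq _ _ := rfl
  jr_hcompSq _ _ := rfl
  jl_jl_assoc _ _ _ := rfl
  jr_jl_assoc _ _ _ := rfl
  jr_assoc _ _ _ := rfl
  jr_leftUnitor _ := rfl
  jl_rightUnitor _ := rfl
  isInitial := IsInitial.ofUniqueHom (fun _ => ↾PEmpty.elim) (fun _ _ => by ext ⟨⟩)
  inl _ _ := ↾Sum.inl
  inr _ _ := ↾Sum.inr
  isCoproduct _ _ :=
    BinaryCofan.IsColimit.mk _ (fun f g => ↾(Sum.elim f g)) (fun _ _ => rfl) (fun _ _ => rfl)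
      (by
        rintro _ _ _ m rfl rfl
        ext (x | x) <;> rfl)
  inl_tensorMap _ _ := rfl
  inr_tensorMap _ _ := rfl
  inl_inl_assocObj _ _ _ := rfl
  inr_inl_assocObj _ _ _ := rfl
  inr_assocObj _ _ _ := rfl
  inr_leftUnitorObj _ := rfl
  inl_rightUnitorObj _ := rfl
  inl_braidObj _ _ := rfl
  inr_braidObj _ _ := rfl
  kl P P' := sumInl P.apex P'.apex
  kr P P' := sumInr P.apex P'.apex
  isCoproduct_apex P P' := sumIsColimit P.apex P'.apex
  -- The two sides have different expressions for the map out of the empty set of transitions, so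
  -- only the places can be compared by `rfl`.
  inl_tensorHor_i _ _ := hom_ext_of_places fun _ => rfl
  inr_tensorHor_i _ _ := hom_ext_of_places fun _ => rfl
  inl_tensorHor_o _ _ := hom_ext_of_places fun _ => rfl
  inr_tensorHor_o _ _ := hom_ext_of_places fun _ => rfl
  kl_tensorSq _ _ := rfl
  kr_tensorSq _ _ := rfl
  kl_kl_tensorAssoc _ _ _ := rfl
  kr_kl_tensorAssoc _ _ _ := rfl
  kr_tensorAssoc _ _ _ := rfl
  kr_tensorLeftUnitor _ := rfl
  kl_tensorRightUnitor _ := rfl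
  kl_braid _ _ := rfl
  kr_braid _ _ := rfl
  kl_jl_chi _ _ _ _ := rfl
  kr_jl_chi _ _ _ _ := rfl
  kl_jr_chi _ _ _ _ := rfl
  kr_jr_chi _ _ _ _ := rfl

end OpenPetri

end

theorem mainTheorem1 :
    ∃ D : SymmetricMonoidalDoubleCategory openPetriCells.{u}, Nonempty (OpenPetriDescription D) :=
  ⟨OpenPetri.symmetricMonoidalDouble, ⟨OpenPetri.description⟩⟩
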